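/- Let $X$ be a Tychonoff space and let $C_p(X)$ be the space of continuous real-valued functions on $X$ with the topology of pointwise convergence. Suppose that $C_p(X)$ is $\kappa$-Fréchet–Urysohn, i.e. for every open $U\subseteq C_p(X)$ and every $g\in\overline{U}$ there is a sequence in $U$ converging to $g$. Then $X$ is $B_\pi$-scattered: for every nonempty Baire space $B$ with a countable $\pi$-base and every continuous map $f:B\to X$ there is a nonempty open set $U\subseteq B$ such that $f(U)$ is finite. (A $\pi$-base of $B$ is a family of nonempty open sets such that every nonempty open subset of $B$ contains a member of the family.) Hence $X$ is also $k$-scattered: every compact Hausdorff subspace $K$ of $X$ is scattered, i.e. every nonempty subspace of $K$ has an isolated point. Here "hence" means that every $B_\pi$-scattered Tychonoff space is $k$-scattered. -/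

import Mathlib

open Set Filter Topology

universe u v

/-- `C_p(X)`: the continuous real-valued functions on `X`, with the topology of pointwise
convergence, i.e. the subspace topology inherited from the product `X → ℝ`. -/
abbrev Cp (X : Type u) [TopologicalSpace X] : Type u :=
  {f : X → ℝ // Continuous f}

/-- A space is `κ`-Fréchet–Urysohn if every point of the closure of an open set `U` is the limit
of a sequence of points of `U`. -/
def IsKappaFrechetUrysohn (Y : Type u) [TopologicalSpace Y] : Prop :=
  ∀ U : Set Y, IsOpen U → ∀ y ∈ closure U,
    ∃ a : ℕ → Y, (∀ n, a n ∈ U) ∧ Tendsto a atTop (𝓝 y)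

/-- A `π`-base: a family of nonempty open sets such that every nonempty open set contains a
member of the family. -/
def IsPiBase {B : Type v} [TopologicalSpace B] (P : Set (Set B)) : Prop :=
  (∀ V ∈ P, IsOpen V ∧ V.Nonempty) ∧
    ∀ U : Set B, IsOpen U → U.Nonempty → ∃ V ∈ P, V ⊆ U

/-- `X` is `B_π`-scattered: for every (nonempty) Baire space `B` with a countable `π`-base and
every continuous map `f : B → X`, some nonempty open subset of `B` has finite image.
The universe of `B` is independent of that of `X`. -/
def IsBPiScattered (X : Type u) [TopologicalSpace X] : Prop :=
  ∀ (B : Type v) [TopologicalSpace B] [BaireSpace B] [Nonempty B],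
    (∃ P : Set (Set B), P.Countable ∧ IsPiBase P) →
      ∀ f : B → X, Continuous f →
        ∃ U : Set B, IsOpen U ∧ U.Nonempty ∧ (f '' U).Finite

/-- A space is scattered if every nonempty subspace has an isolated point. -/
def IsScatteredSpace (Y : Type u) [TopologicalSpace Y] : Prop :=
  ∀ S : Set Y, S.Nonempty → ∃ x : S, IsOpen ({x} : Set S)

/-- `X` is `k`-scattered: every compact Hausdorff subspace of `X` is scattered. -/
def IsKScattered (X : Type u) [TopologicalSpace X] : Prop :=
  ∀ K : Set X, IsCompact K → T2Space K → IsScatteredSpace K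

/-!
If every nonempty open subset of `B` had infinite image under `f : B → X`, then for the members
`V i` of a countable `π`-base and distinct points `e n` of `X`, the zero function would lie in the
closure of the open set of all `g` such that, for some `n`, `g (e n) > 1` and `g` exceeds `1`
somewhere on each of `f (V 0), …, f (V n)`. A sequence `a k → 0` from this set has its indices `n`
tending to infinity, because `a k (e j) > 1` for only finitely many `k`. Hence each `V i` contains,
for all large `k`, a point `b` with `a k (f b) > 1`, and the Baire property gives a single `b` with
`a k (f b) > 1` for infinitely many `k`, contradicting pointwise convergence.

If a compact Hausdorff space is not scattered, it contains a Cantor scheme of closed sets. A choice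
of one point on each branch extends to a map `F` from the Stone–Čech compactification of the
discrete Cantor set, and by disjointness the canonical projection `q` of that compactification onto
the Cantor space factors through `F`. A closed set `E` on which `q` is irreducible is a Baire space
with a countable `π`-base, and a nonempty open subset of `E` with finite image under `F` would
yield a nonempty finite open subset of the Cantor space.
-/

universe w

theorem mem_closure_of_forall_finite_exists_eq {ι : Type*} {π : ι → Type*}
    [∀ i, TopologicalSpace (π i)] {T : Set (∀ i, π i)} {h : ∀ i, π i}
    (hT : ∀ A : Set ι, A.Finite → ∃ g ∈ T, ∀ i ∈ A, g i = h i) : h ∈ closure T := by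
  rw [mem_closure_iff_nhds]
  intro W hW
  rw [nhds_pi, Filter.mem_pi] at hW
  obtain ⟨A, hA, t, ht, htW⟩ := hW
  obtain ⟨g, hgT, hgA⟩ := hT A hA
  exact ⟨g, htW fun i hi => hgA i hi ▸ mem_of_mem_nhds (ht i), hgT⟩

theorem exists_continuous_forall_mem_eq {X 𝕜 : Type*} [TopologicalSpace X] [Field 𝕜]
    [TopologicalSpace 𝕜] [IsTopologicalRing 𝕜] (hsep : {f : X → 𝕜 | Continuous f}.SeparatesPoints)
    (A : Finset X) (h : X → 𝕜) : ∃ g : X → 𝕜, Continuous g ∧ ∀ x ∈ A, g x = h x := by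
  classical
  have hnode : ∀ a d : X, ∃ φ : X → 𝕜, Continuous φ ∧ (a ≠ d → φ a = 0 ∧ φ d = 1) := by
    intro a d
    rcases eq_or_ne a d with rfl | hne
    · exact ⟨0, continuous_zero, fun hne => (hne rfl).elim⟩
    · obtain ⟨f, hf, hfad⟩ := hsep hne
      replace hf : Continuous f := hf
      have hsub : f d - f a ≠ 0 := sub_ne_zero.2 hfad.symm
      exact ⟨fun x => (f x - f a) / (f d - f a), by fun_prop, fun _ => by simp [hsub]⟩
  choose φ hφ hφad using hnode
  -- Lagrange interpolation, with `φ a d` in the role of `(X - a) / (d - a)`.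
  refine ⟨fun x => ∑ d ∈ A, h d * ∏ a ∈ A.erase d, φ a d x, by fun_prop, fun x hx => ?_⟩
  have hdiag : ∏ a ∈ A.erase x, φ a x x = 1 :=
    Finset.prod_eq_one fun a ha => (hφad a x (Finset.ne_of_mem_erase ha)).2
  have hoff : ∀ d ∈ A, d ≠ x → ∏ a ∈ A.erase d, φ a d x = 0 := fun d _ hdx =>
    Finset.prod_eq_zero (Finset.mem_erase.2 ⟨hdx.symm, hx⟩) (hφad x d hdx.symm).1
  calc ∑ d ∈ A, h d * ∏ a ∈ A.erase d, φ a d x = h x * ∏ a ∈ A.erase x, φ a x x :=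
        Finset.sum_eq_single_of_mem x hx fun d hd hdx => by rw [hoff d hd hdx, mul_zero]
    _ = h x := by rw [hdiag, mul_one]

theorem preimage_closure_subset_of_isDenseInducing {Y Z : Type*} [TopologicalSpace Y]
    [TopologicalSpace Z] {i : Y → Z} (hi : IsDenseInducing i) {T : Set Z} (hT : IsOpen T) :
    i ⁻¹' closure T ⊆ closure (i ⁻¹' T) := by
  rw [hi.isInducing.closure_eq_preimage_closure_image, image_preimage_eq_inter_range]
  exact preimage_mono (closure_minimal (hi.dense.open_subset_closure_inter hT) isClosed_closure)

theorem Cp.isDenseInducing_val {X : Type u} [TopologicalSpace X]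
    (hsep : {f : X → ℝ | Continuous f}.SeparatesPoints) :
    IsDenseInducing (Subtype.val : Cp X → X → ℝ) := by
  refine ⟨.subtypeVal, fun h => mem_closure_of_forall_finite_exists_eq fun A hA => ?_⟩
  obtain ⟨g, hg, hgh⟩ := exists_continuous_forall_mem_eq hsep hA.toFinset h
  exact ⟨g, ⟨⟨g, hg⟩, rfl⟩, fun x hx => hgh x (hA.mem_toFinset.2 hx)⟩

theorem IsKappaFrechetUrysohn.exists_tendsto_eventually_mem {Y : Type*} [TopologicalSpace Y]
    (hY : IsKappaFrechetUrysohn Y) {U W : ℕ → Set Y} (hU : ∀ n, IsOpen (U n)) (hanti : Antitone U)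
    (hW : ∀ n, IsOpen (W n)) {y : Y} (hyW : ∀ n, y ∉ closure (W n))
    (hy : y ∈ closure (⋃ n, U n ∩ W n)) :
    ∃ a : ℕ → Y, Tendsto a atTop (𝓝 y) ∧ ∀ n, ∀ᶠ k in atTop, a k ∈ U n := by
  obtain ⟨a, haUW, ha⟩ := hY _ (isOpen_iUnion fun n => (hU n).inter (hW n)) y hy
  refine ⟨a, ha, fun n => ?_⟩
  choose N hNU hNW using fun k => mem_iUnion.1 (haUW k)
  -- The sequence meets each `W j` only finitely often, so the indices `N k` tend to infinity.
  have havoid : ∀ j, ∀ᶠ k in atTop, a k ∉ W j := fun j =>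
    (ha.eventually (isClosed_closure.isOpen_compl.mem_nhds (hyW j))).mono
      fun _ hk hkW => hk (subset_closure hkW)
  filter_upwards [(eventually_all_finite (finite_Iio n)).2 fun j _ => havoid j] with k hk
  exact hanti (not_lt.1 fun hlt => hk (N k) hlt (hNW k)) (hNU k)

theorem isOpen_setOf_lt_apply {X : Type*} (c : ℝ) (x : X) : IsOpen {g : X → ℝ | c < g x} :=
  isOpen_lt continuous_const (continuous_apply x)

theorem isOpen_setOf_forall_le_exists_lt_apply {X : Type*} (c : ℝ) (S : ℕ → Set X) (n : ℕ) :
    IsOpen {g : X → ℝ | ∀ i ≤ n, ∃ x ∈ S i, c < g x} := by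
  have heq : {g : X → ℝ | ∀ i ≤ n, ∃ x ∈ S i, c < g x} =
      ⋂ i ∈ Iic n, ⋃ x ∈ S i, {g | c < g x} := by
    ext
    simp
  rw [heq]
  exact (finite_Iic n).isOpen_biInter fun i _ => isOpen_biUnion fun x _ =>
    isOpen_setOf_lt_apply c x

theorem zero_mem_closure_iUnion_of_infinite {X : Type*} (c : ℝ) {S : ℕ → Set X}
    (hS : ∀ i, (S i).Infinite) {e : ℕ → X} (he : e.Injective) :
    (0 : X → ℝ) ∈ closure
      (⋃ n, {g : X → ℝ | ∀ i ≤ n, ∃ x ∈ S i, c < g x} ∩ {g | c < g (e n)}) := by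
  refine mem_closure_of_forall_finite_exists_eq fun A hA => ?_
  obtain ⟨n, hn⟩ : ∃ n, e n ∉ A := (hA.preimage he.injOn).exists_notMem
  have hlarge : ∀ x ∉ A, c < Aᶜ.indicator (fun _ => c + 1) x := fun x hx => by simp [hx]
  refine ⟨Aᶜ.indicator fun _ => c + 1, mem_iUnion.2 ⟨n, fun i _ => ?_, hlarge _ hn⟩,
    fun x hx => by simp [hx]⟩
  obtain ⟨x, hxS, hxA⟩ := (hS i).exists_notMem_finite hA
  exact ⟨x, hxS, hlarge x hxA⟩

theorem IsKappaFrechetUrysohn.exists_tendsto_zero_of_infinite {X : Type u} [TopologicalSpace X]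
    (hX : IsKappaFrechetUrysohn (Cp X)) (hsep : {f : X → ℝ | Continuous f}.SeparatesPoints)
    {S : ℕ → Set X} (hS : ∀ i, (S i).Infinite) :
    ∃ a : ℕ → Cp X, (∀ x, Tendsto (fun k => (a k).1 x) atTop (𝓝 0)) ∧
      ∀ i, ∀ᶠ k in atTop, ∃ x ∈ S i, 1 < (a k).1 x := by
  let e : ℕ → X := Subtype.val ∘ (hS 0).natEmbedding
  have he : e.Injective := Subtype.val_injective.comp (hS 0).natEmbedding.injective
  let U : ℕ → Set (X → ℝ) := fun n => {g | ∀ i ≤ n, ∃ x ∈ S i, 1 < g x}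
  let W : ℕ → Set (X → ℝ) := fun n => {g | 1 < g (e n)}
  have hU : ∀ n, IsOpen (U n) := isOpen_setOf_forall_le_exists_lt_apply 1 S
  have hW : ∀ n, IsOpen (W n) := fun n => isOpen_setOf_lt_apply 1 (e n)
  have hWzero : ∀ n, (0 : X → ℝ) ∉ closure (W n) := fun n h => by
    have hle : (1 : ℝ) ≤ 0 := closure_lt_subset_le continuous_const (continuous_apply (e n)) h
    exact absurd hle (by norm_num)
  have hval : Continuous (Subtype.val : Cp X → X → ℝ) := continuous_subtype_val
  let z : Cp X := ⟨0, continuous_zero⟩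
  have hzero : z ∈ closure (⋃ n, (Subtype.val ⁻¹' U n ∩ Subtype.val ⁻¹' W n : Set (Cp X))) := by
    simpa only [preimage_iUnion, preimage_inter] using
      preimage_closure_subset_of_isDenseInducing (Cp.isDenseInducing_val hsep)
        (isOpen_iUnion fun n => (hU n).inter (hW n)) (zero_mem_closure_iUnion_of_infinite 1 hS he)
  obtain ⟨a, ha, haU⟩ := hX.exists_tendsto_eventually_mem (fun n => (hU n).preimage hval)
    (fun m n hmn g hg i hi => hg i (hi.trans hmn)) (fun n => (hW n).preimage hval)
    (fun n h => hWzero n (hval.closure_preimage_subset _ h)) hzero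
  exact ⟨a, tendsto_pi_nhds.1 ((hval.tendsto z).comp ha),
    fun i => (haU i).mono fun k hk => hk i le_rfl⟩

theorem dense_setOf_frequently_mem {B ι : Type*} [TopologicalSpace B] [BaireSpace B]
    {l : Filter ι} [l.IsCountablyGenerated] {O : ι → Set B} (hO : ∀ k, IsOpen (O k))
    (h : ∀ V, IsOpen V → V.Nonempty → ∃ᶠ k in l, (V ∩ O k).Nonempty) :
    Dense {b | ∃ᶠ k in l, b ∈ O k} := by
  obtain ⟨s, hs⟩ := l.exists_antitone_basis
  have heq : {b | ∃ᶠ k in l, b ∈ O k} = ⋂ n, ⋃ k ∈ s n, O k := by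
    ext b
    simp [hs.1.frequently_iff]
  rw [heq]
  refine dense_iInter_of_isOpen (fun n => isOpen_biUnion fun k _ => hO k) fun n => ?_
  rw [dense_iff_inter_open]
  intro V hV hne
  obtain ⟨k, hk, b, hbV, hbO⟩ := hs.1.frequently_iff.1 (h V hV hne) (i := n) trivial
  exact ⟨b, hbV, mem_biUnion hk hbO⟩

theorem IsPiBase.exists_nat_enumeration {B : Type v} [TopologicalSpace B] [Nonempty B]
    {P : Set (Set B)} (hPc : P.Countable) (hP : IsPiBase P) :
    ∃ V : ℕ → Set B, (∀ n, IsOpen (V n) ∧ (V n).Nonempty) ∧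
      ∀ U : Set B, IsOpen U → U.Nonempty → ∃ n, V n ⊆ U := by
  obtain ⟨V₀, hV₀, -⟩ := hP.2 univ isOpen_univ univ_nonempty
  obtain ⟨V, rfl⟩ := hPc.exists_eq_range ⟨V₀, hV₀⟩
  refine ⟨V, fun n => hP.1 _ (mem_range_self n), fun U hU hne => ?_⟩
  obtain ⟨_, ⟨n, rfl⟩, hn⟩ := hP.2 U hU hne
  exact ⟨n, hn⟩

theorem IsKappaFrechetUrysohn.isBPiScattered {X : Type u} [TopologicalSpace X]
    (hX : IsKappaFrechetUrysohn (Cp X)) (hsep : {f : X → ℝ | Continuous f}.SeparatesPoints) :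
    IsBPiScattered.{u, v} X := by
  intro B _ _ _ ⟨P, hPc, hP⟩ f hf
  by_contra! hinf
  obtain ⟨V, hV, hVU⟩ := hP.exists_nat_enumeration hPc
  obtain ⟨a, ha, haV⟩ := hX.exists_tendsto_zero_of_infinite hsep (S := fun i => f '' V i)
    fun i => hinf (V i) (hV i).1 (hV i).2
  have hdense : Dense {b | ∃ᶠ k in atTop, b ∈ {b | 1 < (a k).1 (f b)}} := by
    refine dense_setOf_frequently_mem
      (fun k => isOpen_lt continuous_const ((a k).2.comp hf)) fun U hU hne => ?_
    obtain ⟨i, hi⟩ := hVU U hU hne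
    refine (haV i).frequently.mono ?_
    rintro k ⟨_, ⟨b, hb, rfl⟩, hgt⟩
    exact ⟨b, hi hb, hgt⟩
  obtain ⟨b, hb⟩ := hdense.nonempty
  exact hb (((ha (f b)).eventually_lt_const one_pos).mono fun k hk => hk.not_gt)

theorem IsBPiScattered.of_injective {X : Type u} {Y : Type*} [TopologicalSpace X]
    [TopologicalSpace Y] (hX : IsBPiScattered.{u, v} X) {i : Y → X} (hi : Continuous i)
    (hinj : i.Injective) : IsBPiScattered.{_, v} Y := by
  intro B _ _ _ hP f hf
  obtain ⟨U, hU, hne, hfin⟩ := hX B hP (i ∘ f) (hi.comp hf)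
  exact ⟨U, hU, hne, (image_comp i f U ▸ hfin).of_finite_image hinj.injOn⟩

/-- Irreducible surjections: no proper closed subset of the domain is mapped onto the codomain.
Continuity is not part of the definition. -/
def IsIrreducibleMap {M A : Type*} [TopologicalSpace M] (q : M → A) : Prop :=
  q.Surjective ∧ ∀ E : Set M, IsClosed E → q '' E = univ → E = univ

theorem exists_isIrreducibleMap_domRestrict {M : Type (max v w)} {A : Type w} [TopologicalSpace M]
    [CompactSpace M] [TopologicalSpace A] [T1Space A] {q : M → A} (hq : Continuous q)
    (hsurj : q.Surjective) :
    ∃ E : Set M, CompactSpace E ∧ IsIrreducibleMap (E.domRestrict q) := by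
  obtain ⟨E, hE, hEq, hmin⟩ := exists_compact_surjective_zorn_subset
    (continuous_uliftUp.{w, v}.comp hq) (ULift.up_surjective.comp hsurj)
  have hup : ULift.up.{v} '' (univ : Set A) = univ :=
    image_univ_of_surjective ULift.up_surjective
  refine ⟨E, hE, ?_, fun E₀ hE₀ himage => of_not_not fun hne => hmin E₀ hne hE₀ ?_⟩
  · rw [← range_eq_univ, range_domRestrict]
    exact ULift.up_injective.image_injective (by rw [← image_comp, hEq, hup])
  · change (ULift.up ∘ E.domRestrict q) '' E₀ = univ
    rw [image_comp, himage, hup]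

theorem IsIrreducibleMap.exists_isOpen_preimage_subset {M A : Type*} [TopologicalSpace M]
    [TopologicalSpace A] {q : M → A} (hirr : IsIrreducibleMap q) (hq : IsClosedMap q) {U : Set M}
    (hU : IsOpen U) (hne : U.Nonempty) : ∃ W : Set A, IsOpen W ∧ W.Nonempty ∧ q ⁻¹' W ⊆ U := by
  refine ⟨(q '' Uᶜ)ᶜ, (hq _ hU.isClosed_compl).isOpen_compl, ?_, ?_⟩
  · rw [nonempty_compl]
    exact fun h => hne.ne_empty (compl_univ_iff.1 (hirr.2 _ hU.isClosed_compl h))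
  · rw [preimage_compl, compl_subset_comm]
    exact subset_preimage_image q _

theorem IsIrreducibleMap.exists_countable_isPiBase {M A : Type*} [TopologicalSpace M]
    [TopologicalSpace A] [SecondCountableTopology A] {q : M → A} (hirr : IsIrreducibleMap q)
    (hqc : Continuous q) (hq : IsClosedMap q) : ∃ P : Set (Set M), P.Countable ∧ IsPiBase P := by
  have hbasis := TopologicalSpace.isBasis_countableBasis A
  refine ⟨(q ⁻¹' ·) '' TopologicalSpace.countableBasis A,
    (TopologicalSpace.countable_countableBasis A).image _, ?_, fun U hU hne => ?_⟩
  · rintro _ ⟨W, hW, rfl⟩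
    exact ⟨(hbasis.isOpen hW).preimage hqc,
      (TopologicalSpace.nonempty_of_mem_countableBasis hW).preimage hirr.1⟩
  · obtain ⟨W, hW, ⟨x, hx⟩, hWU⟩ := hirr.exists_isOpen_preimage_subset hq hU hne
    obtain ⟨W', hW', -, hW'W⟩ := hbasis.exists_subset_of_mem_open hx hW
    exact ⟨q ⁻¹' W', mem_image_of_mem _ hW', (preimage_mono hW'W).trans hWU⟩

theorem IsBPiScattered.exists_isOpen_finite_of_factorsThrough {X : Type u} [TopologicalSpace X]
    (hX : IsBPiScattered.{u, max v w} X) {M : Type (max v w)} [TopologicalSpace M]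
    [CompactSpace M] [T2Space M] {A : Type w} [TopologicalSpace A] [T2Space A]
    [SecondCountableTopology A] [Nonempty A] {F : M → X} (hF : Continuous F) {q : M → A}
    (hq : Continuous q) (hsurj : q.Surjective) (hqF : q.FactorsThrough F) :
    ∃ W : Set A, IsOpen W ∧ W.Nonempty ∧ W.Finite := by
  obtain ⟨r, rfl⟩ := (Function.factorsThrough_iff q).1 hqF
  obtain ⟨E, _, hirr⟩ := exists_isIrreducibleMap_domRestrict.{v, w} hq hsurj
  have hqE : Continuous (E.domRestrict (r ∘ F)) := hq.comp continuous_subtype_val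
  have : Nonempty E := hirr.1.nonempty
  obtain ⟨U, hU, hne, hfin⟩ := hX E (hirr.exists_countable_isPiBase hqE hqE.isClosedMap)
    (E.domRestrict F) (hF.comp continuous_subtype_val)
  obtain ⟨W, hW, hWne, hWU⟩ := hirr.exists_isOpen_preimage_subset hqE.isClosedMap hU hne
  refine ⟨W, hW, hWne, (hfin.image r).subset ?_⟩
  calc W = E.domRestrict (r ∘ F) '' (E.domRestrict (r ∘ F) ⁻¹' W) :=
        (image_preimage_eq W hirr.1).symm
    _ ⊆ E.domRestrict (r ∘ F) '' U := image_mono hWU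
    _ = r '' (E.domRestrict F '' U) := image_comp r (E.domRestrict F) U

theorem exists_perfect_nonempty_of_not_isScatteredSpace {Y : Type*} [TopologicalSpace Y]
    (hY : ¬ IsScatteredSpace Y) : ∃ C : Set Y, Perfect C ∧ C.Nonempty := by
  simp only [IsScatteredSpace, not_forall, not_exists] at hY
  obtain ⟨S, hS, hiso⟩ := hY
  refine ⟨closure S, Preperfect.perfect_closure fun x hx => ?_, hS.closure⟩
  have hacc : AccPt (⟨x, hx⟩ : S) (𝓟 univ) := by
    have hne := hiso ⟨x, hx⟩
    rw [isOpen_singleton_iff_punctured_nhds] at hne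
    simpa [AccPt] using neBot_iff.2 hne
  simpa using hacc.map continuous_subtype_val.continuousAt Subtype.val_injective

theorem exists_cantorScheme_of_perfect {X : Type*} [TopologicalSpace X] [T25Space X] {C : Set X}
    (hC : Perfect C) (hne : C.Nonempty) :
    ∃ D : List Bool → Set X, CantorScheme.Antitone D ∧ CantorScheme.Disjoint D ∧
      ∀ l, IsClosed (D l) ∧ (D l).Nonempty := by
  choose C₀ C₁ h₀ h₁ hdisj using
    fun E : {E : Set X // Perfect E ∧ E.Nonempty} => E.2.1.splitting E.2.2
  let D : List Bool → {E : Set X // Perfect E ∧ E.Nonempty} := fun l =>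
    l.rec ⟨C, hC, hne⟩ fun a _ E =>
      bif a then ⟨C₁ E, (h₁ E).1, (h₁ E).2.1⟩ else ⟨C₀ E, (h₀ E).1, (h₀ E).2.1⟩
  refine ⟨fun l => (D l).1, ?_, ?_, fun l => ⟨(D l).2.1.closed, (D l).2.2⟩⟩
  · rintro l (_ | _)
    exacts [(h₀ (D l)).2.2, (h₁ (D l)).2.2]
  · rintro l (_ | _) (_ | _) hab
    exacts [absurd rfl hab, hdisj (D l), (hdisj (D l)).symm, absurd rfl hab]

open PiNat in
theorem eq_of_forall_mem_res_of_disjoint {X β : Type*} {D : List β → Set X}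
    (hD : CantorScheme.Disjoint D) {σ τ : ℕ → β} {x : X} (hσ : ∀ n, x ∈ D (res σ n))
    (hτ : ∀ n, x ∈ D (res τ n)) : σ = τ := by
  refine res_injective (funext fun n => ?_)
  induction n with
  | zero => rfl
  | succ n ih =>
    have hσ' := hσ (n + 1)
    rw [res_succ, ih] at hσ'
    rw [res_succ, res_succ, ih, of_not_not fun hne =>
      (hD _ hne).notMem_of_mem_left hσ' (res_succ τ n ▸ hτ (n + 1))]

open PiNat in
theorem ultrafilter_extend_mem_res {X β ι : Type*} [TopologicalSpace X] [CompactSpace X]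
    [T2Space X] [TopologicalSpace β] [DiscreteTopology β] [CompactSpace β] {D : List β → Set X}
    (hD : ∀ l, IsClosed (D l)) {s : ι → X} {t : ι → ℕ → β} (hst : ∀ i n, s i ∈ D (res (t i) n))
    (p : Ultrafilter ι) (n : ℕ) :
    Ultrafilter.extend s p ∈ D (res (Ultrafilter.extend t p) n) := by
  have hs : Tendsto s p (𝓝 (Ultrafilter.extend s p)) := ultrafilter_extend_eq_iff.1 rfl
  have ht : Tendsto t p (𝓝 (Ultrafilter.extend t p)) := ultrafilter_extend_eq_iff.1 rfl
  refine (hD _).mem_of_tendsto hs ?_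
  filter_upwards [ht ((isOpen_cylinder _ _ n).mem_nhds (self_mem_cylinder _ n))] with i hi
  have hres : res (t i) n = res (Ultrafilter.extend t p) n := by
    simpa [cylinder_eq_res] using hi
  exact hres ▸ hst i n

open PiNat in
theorem exists_continuous_factorsThrough_of_perfect {X : Type*} [TopologicalSpace X]
    [CompactSpace X] [T2Space X] {C : Set X} (hC : Perfect C) (hne : C.Nonempty) :
    ∃ F : Ultrafilter (ULift.{v} (ℕ → Bool)) → X, Continuous F ∧
      (Ultrafilter.extend (ULift.down : ULift.{v} (ℕ → Bool) → _)).FactorsThrough F := by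
  obtain ⟨D, hanti, hdisj, hD⟩ := exists_cantorScheme_of_perfect hC hne
  have hbranch : ∀ σ : ULift.{v} (ℕ → Bool), ∃ x, ∀ n, x ∈ D (res σ.down n) := fun σ => by
    obtain ⟨x, hx⟩ := IsCompact.nonempty_iInter_of_sequence_nonempty_isCompact_isClosed
      (fun n => D (res σ.down n)) (fun n => hanti _ _) (fun n => (hD _).2)
      (hD _).1.isCompact fun n => (hD _).1
    exact ⟨x, mem_iInter.1 hx⟩
  choose s hs using hbranch
  have hmem := ultrafilter_extend_mem_res (fun l => (hD l).1) hs
  refine ⟨Ultrafilter.extend s, continuous_ultrafilter_extend s, fun p r hpr => ?_⟩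
  exact eq_of_forall_mem_res_of_disjoint hdisj (hmem p) fun n => hpr ▸ hmem r n

theorem perfectSpace_pi {ι : Type*} {π : ι → Type*} [∀ i, TopologicalSpace (π i)] [Infinite ι]
    [∀ i, Nontrivial (π i)] : PerfectSpace (∀ i, π i) := by
  classical
  refine ⟨preperfect_iff_nhds.2 fun x _ U hU => ?_⟩
  rw [nhds_pi, Filter.mem_pi] at hU
  obtain ⟨A, hA, t, ht, htU⟩ := hU
  obtain ⟨j, hj⟩ := hA.exists_notMem
  obtain ⟨z, hz⟩ := exists_ne (x j)
  refine ⟨Function.update x j z, ⟨htU fun i hi => ?_, mem_univ _⟩, fun h => hz ?_⟩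
  · rw [Function.update_of_ne (ne_of_mem_of_not_mem hi hj)]
    exact mem_of_mem_nhds (ht i)
  · simpa using congrFun h j

theorem IsBPiScattered.isScatteredSpace {Y : Type u} [TopologicalSpace Y] [CompactSpace Y]
    [T2Space Y] (hY : IsBPiScattered.{u, v} Y) : IsScatteredSpace Y := by
  by_contra hscat
  obtain ⟨C, hC, hne⟩ := exists_perfect_nonempty_of_not_isScatteredSpace hscat
  obtain ⟨F, hF, hfactor⟩ := exists_continuous_factorsThrough_of_perfect.{v} hC hne
  have hsurj : (Ultrafilter.extend (ULift.down : ULift.{v} (ℕ → Bool) → _)).Surjective :=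
    fun σ => ⟨pure ⟨σ⟩, ultrafilter_extend_pure _ _⟩
  obtain ⟨W, hW, ⟨σ, hσ⟩, hfin⟩ := hY.exists_isOpen_finite_of_factorsThrough.{u, v, 0} hF
    (continuous_ultrafilter_extend _) hsurj hfactor
  have : PerfectSpace (ℕ → Bool) := perfectSpace_pi
  exact infinite_of_mem_nhds σ (hW.mem_nhds hσ) hfin

theorem IsBPiScattered.isKScattered {X : Type u} [TopologicalSpace X]
    (hX : IsBPiScattered.{u, v} X) : IsKScattered X := by
  intro K hK _
  have : CompactSpace K := isCompact_iff_compactSpace.1 hK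
  exact (hX.of_injective continuous_subtype_val Subtype.val_injective).isScatteredSpace

theorem mainTheorem5_general (X : Type u) [TopologicalSpace X] :
    ({f : X → ℝ | Continuous f}.SeparatesPoints → IsKappaFrechetUrysohn (Cp X) →
        IsBPiScattered.{u, v} X ∧ IsKScattered X) ∧
      (IsBPiScattered.{u, w} X → IsKScattered X) :=
  ⟨fun hsep hX =>
      have hscat : IsBPiScattered.{u, v} X := hX.isBPiScattered hsep
      ⟨hscat, hscat.isKScattered⟩,
    IsBPiScattered.isKScattered⟩

theorem mainTheorem5 (X : Type u) [TopologicalSpace X] [T35Space X] :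
    (IsKappaFrechetUrysohn (Cp X) → IsBPiScattered.{u, v} X ∧ IsKScattered X) ∧
      (IsBPiScattered.{u, u} X → IsKScattered X) :=
  have h := mainTheorem5_general.{u, v, u} X
  ⟨h.1 separatesPoints_continuous_of_t35Space, h.2⟩
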